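/- Let $H$ be a complex Hilbert space with inner product $\langle\cdot,\cdot\rangle$ conjugate-linear in the first argument and linear in the second, let $A$ be a unitary operator on $H$ and let $f_0\in H$. Put $f_k=A^kf_0$ for $k\in\mathbb{Z}$, let $H_1$ be the closed linear span of $\{f_k : k\in\mathbb{Z}\}$, and put $a_j=\langle A^jf_0,f_0\rangle$ for $j\in\mathbb{Z}$ and $\alpha(p)=\sum_{l\in\mathbb{Z}}a_le^{ipl}$ for $p\in\mathbb{R}$. Suppose that $\{a_j\}\in l^1(\mathbb{Z})$ and that $\alpha(p)\neq 0$ for all $p\in[0,2\pi)$. Then $\alpha(p)$ is real and strictly positive for every $p$, and with $$c_l=\frac{1}{2\pi}\int_0^{2\pi}\frac{e^{-ipl}}{\sqrt{\alpha(p)}}\,dp,\qquad d_l=\frac{1}{2\pi}\int_0^{2\pi}\sqrt{\alpha(p)}\,e^{-ipl}\,dp\qquad(l\in\mathbb{Z})$$ the following holds. (i) $\sum_{k}|c_k|<\infty$, so that $X=\sum_{k\in\mathbb{Z}}c_kA^k$ converges in operator norm to a bounded operator on $H$, which maps $H_1$ into itself; and the vectors $\varphi_n=A^nXf_0$, $n\in\mathbb{Z}$,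 are orthonormal. (ii) The orthonormal set $M_1=\{\varphi_n : n\in\mathbb{Z}\}$ is complete in $H_1$ (that is, its closed linear span is $H_1$) if and only if $X$ admits a bounded inverse. This is true with $X$ regarded as an operator on $H$, and also with $X$ regarded as an operator on $H_1$. (iii) If $X$ admits a bounded inverse (on $H$, respectively on $H_1$), then $X^{-1}=\sum_{l\in\mathbb{Z}}d_lA^l$, with convergence in the operator norm (of operators on $H$, respectively on $H_1$). -/

import Mathlib

noncomputable section

namespace UnitaryOrbit

variable {H : Type*} [NormedAddCommGroup H] [InnerProductSpace ℂ H] [CompleteSpace H]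

/-- The orbit vectors `f_k = A ^ k f₀`, `k ∈ ℤ`, of a vector under a unitary operator. -/
def orbit (A : unitary (H →L[ℂ] H)) (f₀ : H) (k : ℤ) : H :=
  ((A ^ k : unitary (H →L[ℂ] H)) : H →L[ℂ] H) f₀

/-- The closed linear span of the orbit `{A ^ k f₀ : k ∈ ℤ}`. -/
def orbitSpan (A : unitary (H →L[ℂ] H)) (f₀ : H) : Submodule ℂ H :=
  (Submodule.span ℂ (Set.range (orbit A f₀))).topologicalClosure

/-- The overlap coefficients `a_j = ⟨A ^ j f₀, f₀⟩`; the inner product is conjugate-linear in the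
first argument and linear in the second. -/
def overlap (A : unitary (H →L[ℂ] H)) (f₀ : H) (j : ℤ) : ℂ :=
  inner ℂ (orbit A f₀ j) f₀

/-- The symbol `α(p) = ∑ a_l exp(i p l)`. -/
def symbol (A : unitary (H →L[ℂ] H)) (f₀ : H) (p : ℝ) : ℂ :=
  ∑' l : ℤ, overlap A f₀ l * Complex.exp (Complex.I * p * l)

/-- The Fourier coefficients `c_l = (1 / 2π) ∫_0^{2π} exp(-i p l) / √α(p) dp`. -/
def cCoeff (A : unitary (H →L[ℂ] H)) (f₀ : H) (l : ℤ) : ℂ :=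
  fourierCoeffOn Real.two_pi_pos (fun p : ℝ => ((1 / √(symbol A f₀ p).re : ℝ) : ℂ)) l

/-- The Fourier coefficients `d_l = (1 / 2π) ∫_0^{2π} exp(-i p l) √α(p) dp`. -/
def dCoeff (A : unitary (H →L[ℂ] H)) (f₀ : H) (l : ℤ) : ℂ :=
  fourierCoeffOn Real.two_pi_pos (fun p : ℝ => ((√(symbol A f₀ p).re : ℝ) : ℂ)) l

/-- The operator `X = ∑ c_k A ^ k` on the whole space, the series being taken in operator norm. -/
def opX (A : unitary (H →L[ℂ] H)) (f₀ : H) : H →L[ℂ] H :=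
  ∑' k : ℤ, cCoeff A f₀ k • ((A ^ k : unitary (H →L[ℂ] H)) : H →L[ℂ] H)

/-- The vectors `φ_n = A ^ n X f₀`. -/
def phi (A : unitary (H →L[ℂ] H)) (f₀ : H) (n : ℤ) : H :=
  orbit A (opX A f₀ f₀) n

theorem zpow_mem_orbitSpan (A : unitary (H →L[ℂ] H)) (f₀ : H) (k : ℤ) {h : H}
    (hh : h ∈ orbitSpan A f₀) :
    ((A ^ k : unitary (H →L[ℂ] H)) : H →L[ℂ] H) h ∈ orbitSpan A f₀ := by
  have key : Set.MapsTo ((A ^ k : unitary (H →L[ℂ] H)) : H →L[ℂ] H)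
      (Submodule.span ℂ (Set.range (orbit A f₀)) : Set H)
      (Submodule.span ℂ (Set.range (orbit A f₀)) : Set H) := by
    intro x hx
    have hle : Submodule.span ℂ (Set.range (orbit A f₀)) ≤
        (Submodule.span ℂ (Set.range (orbit A f₀))).comap
          (((A ^ k : unitary (H →L[ℂ] H)) : H →L[ℂ] H) : H →ₗ[ℂ] H) := by
      rw [Submodule.span_le]
      rintro _ ⟨j, rfl⟩
      refine Submodule.subset_span ⟨k + j, ?_⟩
      simp [orbit, zpow_add]
    exact hle hx
  exact key.closure (ContinuousLinearMap.continuous _) hh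

theorem opX_mem_orbitSpan (A : unitary (H →L[ℂ] H)) (f₀ : H) {h : H}
    (hh : h ∈ orbitSpan A f₀) : opX A f₀ h ∈ orbitSpan A f₀ := by
  by_cases hs : Summable fun k : ℤ =>
      cCoeff A f₀ k • ((A ^ k : unitary (H →L[ℂ] H)) : H →L[ℂ] H)
  · have h1 := (hs.hasSum.mapL (ContinuousLinearMap.apply ℂ H h))
    have hc : IsClosed (orbitSpan A f₀ : Set H) := Submodule.isClosed_topologicalClosure _
    refine hc.mem_of_tendsto h1 (Filter.Eventually.of_forall fun s => ?_)
    refine Submodule.sum_mem _ fun k _ => ?_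
    exact Submodule.smul_mem _ _ (zpow_mem_orbitSpan A f₀ k hh)
  · rw [opX, tsum_eq_zero_of_not_summable hs]
    exact Submodule.zero_mem _

/-- The operator `X` as a bounded operator of the closed span of the orbit into itself. -/
def opXOn (A : unitary (H →L[ℂ] H)) (f₀ : H) : orbitSpan A f₀ →L[ℂ] orbitSpan A f₀ :=
  ((opX A f₀).comp (orbitSpan A f₀).subtypeL).codRestrict (orbitSpan A f₀)
    fun h => opX_mem_orbitSpan A f₀ h.2

/-- The operator `A ^ k` as a bounded operator of the closed span of the orbit into itself. -/
def zpowOn (A : unitary (H →L[ℂ] H)) (f₀ : H) (k : ℤ) :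
    orbitSpan A f₀ →L[ℂ] orbitSpan A f₀ :=
  (((A ^ k : unitary (H →L[ℂ] H)) : H →L[ℂ] H).comp (orbitSpan A f₀).subtypeL).codRestrict
    (orbitSpan A f₀) fun h => zpow_mem_orbitSpan A f₀ k h.2

/-- The set `{φ_n}` is complete in the closed span of the orbit: it lies there and its closed
linear span is everything. -/
def PhiComplete (A : unitary (H →L[ℂ] H)) (f₀ : H) : Prop :=
  (Submodule.span ℂ (Set.range (phi A f₀))).topologicalClosure = orbitSpan A f₀

/-- A bounded operator `Y` is a (two-sided) inverse of the bounded operator `T`. -/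
def IsBoundedInverse {E : Type*} [NormedAddCommGroup E] [NormedSpace ℂ E]
    (T Y : E →L[ℂ] E) : Prop :=
  (∀ x, Y (T x) = x) ∧ ∀ x, T (Y x) = x

end UnitaryOrbit

end

open Complex Filter Topology

/-! An absolutely summable trigonometric series can be evaluated at `A` by replacing `exp (i p n)`
with `A ^ n`. Products of functions then become products of operators (`hasSum_seqConv_smul`). Here
`X` corresponds to `α ^ (-1/2)`, and the series with coefficients `d_l` corresponds to `α ^ (1/2)`.
Once both functions have summable coefficients, the two operators are mutually inverse, on `H` and
on `H₁` alike (`mul_eq_one_of_fourierCoeffOn`). So under these hypotheses `X` is always invertible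
and `M₁` is always complete. Both equivalences hold because both of their sides are true.

The analytic core is a Wiener–Lévy theorem, `exists_wienerBound_rpow`. Approximate `F > 0` in Wiener
norm by a trigonometric polynomial `P` and expand `F ^ (-t)` binomially in powers of `(F - P) / P`.
The powers of `P` are smooth, so two integrations by parts bound their Wiener norms, and the
resulting series of norms is dominated by a polynomial times a geometric sequence.

Positivity of `α`: it is real because `a_{-j}` is the conjugate of `a_j`, of constant sign because
it is continuous and never zero, and its mean is `a_0 = ‖f₀‖² ≥ 0`. Orthonormality: `X` is
self-adjoint and commutes with `A`, so `⟨φ_k, φ_0⟩ = ⟨f₀, X² A ^ (-k) f₀⟩` is the `k`-th Fourier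
coefficient of `α⁻¹ α = 1`. -/

/-! ### Convolution of absolutely summable sequences -/

/-- Coefficient convolution on `ℤ`. -/
noncomputable def seqConv {𝕜 : Type*} [NormedField 𝕜] (a b : ℤ → 𝕜) (k : ℤ) : 𝕜 :=
  ∑' j : ℤ, a j * b (k - j)

/-- The shear `(k, j) ↦ (j, k - j)` of `ℤ × ℤ`. -/
def shearEquiv : ℤ × ℤ ≃ ℤ × ℤ where
  toFun x := (x.2, x.1 - x.2)
  invFun y := (y.1 + y.2, y.1)
  left_inv x := by ext <;> simp
  right_inv y := by ext <;> simp

section Convolution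

variable {𝕜 B : Type*} [NormedField 𝕜] [NormedRing B] [NormedAlgebra 𝕜 B] [CompleteSpace B]

theorem summable_smul_of_norm_le_one {E : Type*} [NormedAddCommGroup E] [NormedSpace 𝕜 E]
    [CompleteSpace E] {a : ℤ → 𝕜} {u : ℤ → E} (ha : Summable fun n => ‖a n‖)
    (hu : ∀ n, ‖u n‖ ≤ 1) : Summable fun n => a n • u n := by
  refine Summable.of_norm_bounded ha fun n => ?_
  rw [norm_smul]
  exact mul_le_of_le_one_right (norm_nonneg _) (hu n)

/-- The product is an absolutely convergent double series, regrouped along the lines where the two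
indices have constant sum. Keeping `u` abstract lets one proof serve the characters, the powers of
`A` on `H` and on `H₁`, and the constant `1`. -/
theorem hasSum_seqConv_smul [CompleteSpace 𝕜] {a b : ℤ → 𝕜} (ha : Summable fun n => ‖a n‖)
    (hb : Summable fun n => ‖b n‖) {u : ℤ → B} (hu : ∀ m n, u (m + n) = u m * u n)
    (hu1 : ∀ n, ‖u n‖ ≤ 1) {x y : B} (hx : HasSum (fun n => a n • u n) x)
    (hy : HasSum (fun n => b n • u n) y) :
    HasSum (fun n => seqConv a b n • u n) (x * y) := by
  have hna : Summable fun n => ‖a n • u n‖ := by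
    refine Summable.of_nonneg_of_le (fun _ => norm_nonneg _) (fun n => ?_) ha
    rw [norm_smul]
    exact mul_le_of_le_one_right (norm_nonneg _) (hu1 n)
  have hnb : Summable fun n => ‖b n • u n‖ := by
    refine Summable.of_nonneg_of_le (fun _ => norm_nonneg _) (fun n => ?_) hb
    rw [norm_smul]
    exact mul_le_of_le_one_right (norm_nonneg _) (hu1 n)
  have hm : Summable fun z : ℤ × ℤ => (a z.1 • u z.1) * (b z.2 • u z.2) :=
    summable_mul_of_summable_norm (f := fun n => a n • u n) (g := fun n => b n • u n) hna hnb
  have h : HasSum (fun z : ℤ × ℤ => (a z.1 • u z.1) * (b z.2 • u z.2)) (x * y) :=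
    HasSum.mul (f := fun n => a n • u n) (g := fun n => b n • u n) hx hy hm
  have h2 : HasSum (fun z : ℤ × ℤ => (a z.2 * b (z.1 - z.2)) • u z.1) (x * y) := by
    have h1 := (shearEquiv.hasSum_iff
      (f := fun z : ℤ × ℤ => (a z.1 • u z.1) * (b z.2 • u z.2)) (a := x * y)).2 h
    refine h1.congr_fun fun z => ?_
    simp only [Function.comp, shearEquiv, Equiv.coe_fn_mk]
    rw [smul_mul_smul_comm, ← hu, add_sub_cancel]
  have hs : Summable fun z : ℤ × ℤ => a z.2 * b (z.1 - z.2) :=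
    (shearEquiv.summable_iff (f := fun z : ℤ × ℤ => a z.1 * b z.2)).2
      (summable_mul_of_summable_norm ha hb)
  refine HasSum.prod_fiberwise h2 fun k => ?_
  have h3 : HasSum (fun j => a j * b (k - j)) (seqConv a b k) := (hs.prod_factor k).hasSum
  exact h3.smul_const (u k)

theorem hasSum_seqConv_norm {a b : ℤ → 𝕜} (ha : Summable fun n => ‖a n‖)
    (hb : Summable fun n => ‖b n‖) :
    HasSum (seqConv (fun n => ‖a n‖) (fun n => ‖b n‖)) ((∑' n, ‖a n‖) * ∑' n, ‖b n‖) := by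
  simpa using hasSum_seqConv_smul (𝕜 := ℝ) (B := ℝ) (u := fun _ => 1) (by simpa using ha)
    (by simpa using hb) (by simp) (by simp) (by simpa using ha.hasSum) (by simpa using hb.hasSum)

theorem norm_seqConv_le {a b : ℤ → 𝕜} (ha : Summable fun n => ‖a n‖)
    (hb : Summable fun n => ‖b n‖) (k : ℤ) :
    ‖seqConv a b k‖ ≤ seqConv (fun n => ‖a n‖) (fun n => ‖b n‖) k := by
  have hs := (shearEquiv.summable_iff.2 (summable_mul_of_summable_norm (R := ℝ)
    (f := fun n => ‖a n‖) (g := fun n => ‖b n‖) (by simpa using ha)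
    (by simpa using hb))).prod_factor k
  have hs' : Summable fun j => ‖a j * b (k - j)‖ := by
    simpa [Function.comp_def, shearEquiv] using hs
  simpa [seqConv] using norm_tsum_le_tsum_norm hs'

theorem summable_norm_seqConv {a b : ℤ → 𝕜} (ha : Summable fun n => ‖a n‖)
    (hb : Summable fun n => ‖b n‖) : Summable fun n => ‖seqConv a b n‖ :=
  Summable.of_nonneg_of_le (fun _ => norm_nonneg _) (norm_seqConv_le ha hb)
    (hasSum_seqConv_norm ha hb).summable

theorem tsum_norm_seqConv_le {a b : ℤ → 𝕜} (ha : Summable fun n => ‖a n‖)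
    (hb : Summable fun n => ‖b n‖) :
    ∑' n, ‖seqConv a b n‖ ≤ (∑' n, ‖a n‖) * ∑' n, ‖b n‖ :=
  hasSum_le (norm_seqConv_le ha hb) (summable_norm_seqConv ha hb).hasSum
    (hasSum_seqConv_norm ha hb)

end Convolution

/-! ### Characters of the circle -/

/-- The character `p ↦ exp (i p n)`. -/
noncomputable def circleChar (p : ℝ) (n : ℤ) : ℂ := exp (I * p * n)

theorem circleChar_add (p : ℝ) (m n : ℤ) :
    circleChar p (m + n) = circleChar p m * circleChar p n := by
  simp only [circleChar, ← Complex.exp_add]; push_cast; ring_nf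

theorem norm_circleChar (p : ℝ) (n : ℤ) : ‖circleChar p n‖ = 1 := by
  have : I * p * n = ((p * n : ℝ) : ℂ) * I := by push_cast; ring
  rw [circleChar, this, norm_exp_ofReal_mul_I]

theorem circleChar_zero (p : ℝ) : circleChar p 0 = 1 := by simp [circleChar]

theorem conj_circleChar (p : ℝ) (n : ℤ) :
    (starRingEnd ℂ) (circleChar p n) = circleChar p (-n) := by
  simp [circleChar, ← Complex.exp_conj]

theorem circleChar_periodic (n : ℤ) : Function.Periodic (circleChar · n) (2 * Real.pi) := by
  intro p
  have : I * ((p + 2 * Real.pi : ℝ) : ℂ) * n = I * p * n + n * (2 * Real.pi * I) := by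
    push_cast; ring
  simp only [circleChar]
  rw [this, Complex.exp_add, Complex.exp_int_mul_two_pi_mul_I, mul_one]

theorem hasDerivAt_circleChar (n : ℤ) (p : ℝ) :
    HasDerivAt (circleChar · n) (I * n * circleChar p n) p := by
  have h : HasDerivAt (fun q : ℝ => I * (q : ℂ) * n) (I * n) p := by
    simpa using ((Complex.ofRealCLM.hasDerivAt (x := p)).const_mul I).mul_const (n : ℂ)
  simpa [circleChar, mul_comm] using h.cexp

theorem continuous_circleChar (n : ℤ) : Continuous (circleChar · n) :=
  continuous_iff_continuousAt.2 fun p => (hasDerivAt_circleChar n p).continuousAt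

/-- The period appears as `2 * Real.pi - 0` because `fourierCoeffOn` on an interval uses the circle
of length `b - a`. -/
theorem fourier_coe_eq_circleChar (n : ℤ) (p : ℝ) :
    fourier n (p : AddCircle (2 * Real.pi - 0)) = circleChar p n := by
  rw [fourier_coe_apply, circleChar]
  congr 1
  have : (Real.pi : ℂ) ≠ 0 := by exact_mod_cast Real.pi_ne_zero
  push_cast
  field_simp
  ring

/-! ### The Wiener algebra -/

/-- `F` is the sum of a trigonometric series whose coefficients have absolute sum at most `C`. -/
def WienerBound (F : ℝ → ℂ) (C : ℝ) : Prop :=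
  ∃ a : ℤ → ℂ, (Summable fun n => ‖a n‖) ∧ ∑' n, ‖a n‖ ≤ C ∧
    ∀ p, HasSum (fun n => a n * circleChar p n) (F p)

namespace WienerBound

theorem mul {F G : ℝ → ℂ} {C D : ℝ} (hF : WienerBound F C) (hG : WienerBound G D) :
    WienerBound (fun p => F p * G p) (C * D) := by
  obtain ⟨a, ha, hC, hF⟩ := hF
  obtain ⟨b, hb, hD, hG⟩ := hG
  refine ⟨seqConv a b, summable_norm_seqConv ha hb, (tsum_norm_seqConv_le ha hb).trans ?_,
    fun p => ?_⟩
  · exact mul_le_mul hC hD (tsum_nonneg fun _ => norm_nonneg _)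
      ((tsum_nonneg fun _ => norm_nonneg _).trans hC)
  · exact hasSum_seqConv_smul ha hb (circleChar_add p) (fun n => (norm_circleChar p n).le)
      (hF p) (hG p)

theorem const (c : ℂ) : WienerBound (fun _ => c) ‖c‖ := by
  have h : HasSum (fun n : ℤ => ‖(Pi.single 0 c : ℤ → ℂ) n‖) ‖c‖ := by
    convert hasSum_single (f := fun n : ℤ => ‖(Pi.single 0 c : ℤ → ℂ) n‖) 0 ?_ using 1
    · simp
    · intro n hn; simp [hn]
  refine ⟨Pi.single 0 c, h.summable, h.tsum_eq.le, fun p => ?_⟩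
  convert hasSum_single (f := fun n : ℤ => (Pi.single 0 c : ℤ → ℂ) n * circleChar p n) 0 ?_ using 1
  · simp [circleChar_zero]
  · intro n hn; simp [hn]

theorem pow {F : ℝ → ℂ} {C : ℝ} (hF : WienerBound F C) (n : ℕ) :
    WienerBound (fun p => F p ^ n) (C ^ n) := by
  induction n with
  | zero => simpa using const 1
  | succ n ih => simpa only [pow_succ] using ih.mul hF

theorem mono {F : ℝ → ℂ} {C D : ℝ} (hF : WienerBound F C) (h : C ≤ D) : WienerBound F D := by
  obtain ⟨a, ha, hC, hF⟩ := hF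
  exact ⟨a, ha, hC.trans h, hF⟩

theorem conj {F : ℝ → ℂ} {C : ℝ} (hF : WienerBound F C) :
    WienerBound (fun p => (starRingEnd ℂ) (F p)) C := by
  obtain ⟨a, ha, hC, hF⟩ := hF
  refine ⟨fun n => (starRingEnd ℂ) (a (-n)), ?_, ?_, fun p => ?_⟩
  · simpa [Function.comp_def] using (Equiv.neg ℤ).summable_iff.2 ha
  · simpa using ((Equiv.neg ℤ).tsum_eq (fun n => ‖a n‖)).le.trans hC
  · have h := (Equiv.neg ℤ).hasSum_iff.2 (Complex.hasSum_conj'.2 (hF p))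
    simpa [Function.comp_def, conj_circleChar] using h

theorem add {F G : ℝ → ℂ} {C D : ℝ} (hF : WienerBound F C) (hG : WienerBound G D) :
    WienerBound (fun p => F p + G p) (C + D) := by
  obtain ⟨a, ha, hC, hF⟩ := hF
  obtain ⟨b, hb, hD, hG⟩ := hG
  have hs : Summable fun n => ‖a n + b n‖ :=
    Summable.of_nonneg_of_le (fun _ => norm_nonneg _) (fun n => norm_add_le _ _) (ha.add hb)
  refine ⟨fun n => a n + b n, hs, ?_, fun p => ?_⟩
  · refine (hs.tsum_le_tsum (fun n => norm_add_le _ _) (ha.add hb)).trans ?_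
    rw [ha.tsum_add hb]
    exact add_le_add hC hD
  · simpa [add_mul] using (hF p).add (hG p)

theorem re {F : ℝ → ℂ} {C : ℝ} (hF : WienerBound F C) :
    WienerBound (fun p => ((F p).re : ℂ)) C := by
  have h := (const (1 / 2)).mul (hF.add hF.conj)
  have hF' : (fun p => ((F p).re : ℂ)) =
      fun p => (1 / 2) * (F p + (starRingEnd ℂ) (F p)) := by
    funext p; rw [Complex.add_conj]; push_cast; ring
  rw [hF']
  exact h.mono (by norm_num; linarith)

theorem norm_le {F : ℝ → ℂ} {C : ℝ} (hF : WienerBound F C) (p : ℝ) : ‖F p‖ ≤ C := by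
  obtain ⟨a, ha, hC, hF⟩ := hF
  rw [← (hF p).tsum_eq]
  refine le_trans (norm_tsum_le_tsum_norm ?_) (le_trans (le_of_eq ?_) hC) <;>
    simp [norm_circleChar, ha]

theorem periodic {F : ℝ → ℂ} {C : ℝ} (hF : WienerBound F C) :
    Function.Periodic F (2 * Real.pi) := by
  obtain ⟨a, -, -, hF⟩ := hF
  intro p
  refine (hF (p + 2 * Real.pi)).unique ?_
  convert hF p using 3 with n
  exact circleChar_periodic n p

theorem continuous {F : ℝ → ℂ} {C : ℝ} (hF : WienerBound F C) : Continuous F := by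
  obtain ⟨a, ha, -, hF⟩ := hF
  have : F = fun p => ∑' n, a n * circleChar p n := funext fun p => (hF p).tsum_eq.symm
  rw [this]
  refine continuous_tsum (fun n => continuous_const.mul (continuous_circleChar n)) ha fun n p => ?_
  simp [norm_circleChar]

/-- Completeness of the Wiener algebra in series form: summable bounds make the double family of
coefficients absolutely summable, so the sums over `n` and over frequencies may be exchanged. -/
theorem of_hasSum {F : ℕ → ℝ → ℂ} {C : ℕ → ℝ} (hF : ∀ n, WienerBound (F n) (C n))
    (hC : Summable C) {G : ℝ → ℂ} (hG : ∀ p, HasSum (fun n => F n p) (G p)) :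
    ∃ D, WienerBound G D := by
  choose a ha hle hsum using hF
  have hs : Summable fun x : ℕ × ℤ => ‖a x.1 x.2‖ :=
    (summable_prod_of_nonneg fun _ => norm_nonneg _).2
      ⟨ha, Summable.of_nonneg_of_le (fun n => tsum_nonneg fun _ => norm_nonneg _) hle hC⟩
  have hs' : Summable fun x : ℤ × ℕ => ‖a x.2 x.1‖ := 
    (Equiv.prodComm ℤ ℕ).summable_iff (f := fun x : ℕ × ℤ => ‖a x.1 x.2‖) |>.2 hs
  have hsa : Summable fun k => ‖∑' n, a n k‖ := by
    refine Summable.of_nonneg_of_le (fun _ => norm_nonneg _) (fun k => ?_) hs'.prod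
    exact norm_tsum_le_tsum_norm (hs'.prod_factor k)
  refine ⟨_, fun k => ∑' n, a n k, hsa, le_rfl, fun p => ?_⟩
  have hp : Summable fun x : ℕ × ℤ => a x.1 x.2 * circleChar p x.2 :=
    Summable.of_norm (by simpa [norm_circleChar] using hs)
  have h1 : ∑' x : ℕ × ℤ, a x.1 x.2 * circleChar p x.2 = G p :=
    (HasSum.prod_fiberwise hp.hasSum fun n => hsum n p).unique (hG p)
  have h2 : HasSum (fun x : ℤ × ℕ => a x.2 x.1 * circleChar p x.1) (G p) :=
    (Equiv.prodComm ℤ ℕ).hasSum_iff (f := fun x : ℕ × ℤ => a x.1 x.2 * circleChar p x.2) |>.2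
      (h1 ▸ hp.hasSum)
  refine HasSum.prod_fiberwise h2 fun k => ?_
  have h3 : HasSum (fun n => a n k) (∑' n, a n k) := (hs'.prod_factor k).of_norm.hasSum
  exact h3.mul_right _

end WienerBound

/-! ### Fourier coefficients: uniqueness, and decay for smooth functions -/

/-- Absolute summability permits termwise integration, and orthogonality of the characters isolates
one coefficient. Identities between functions thus become identities between coefficient sequences.
-/
theorem fourierCoeffOn_eq_of_hasSum {a : ℤ → ℂ} (ha : Summable fun n => ‖a n‖) {F : ℝ → ℂ}
    (hF : ∀ p, HasSum (fun n => a n * circleChar p n) (F p)) :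
    fourierCoeffOn Real.two_pi_pos F = a := by
  have : Fact (0 < 2 * Real.pi - 0) := ⟨by simpa using Real.two_pi_pos⟩
  funext n
  have hG : ∀ x : AddCircle (2 * Real.pi - 0), HasSum (fun m => a m * fourier m x)
      (AddCircle.liftIoc (2 * Real.pi - 0) 0 F x) := by
    intro x
    obtain ⟨y, hy, rfl⟩ : ∃ y ∈ Set.Ioc (0 : ℝ) (0 + (2 * Real.pi - 0)), (y : AddCircle _) = x :=
      ⟨AddCircle.equivIoc _ 0 x, (AddCircle.equivIoc _ 0 x).2,
        (AddCircle.equivIoc _ 0).symm_apply_apply x⟩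
    rw [AddCircle.liftIoc_coe_apply hy]
    simpa only [fourier_coe_eq_circleChar] using hF y
  have h := MeasureTheory.hasSum_integral_of_summable_integral_norm
    (μ := AddCircle.haarAddCircle (T := 2 * Real.pi - 0))
    (F := fun m x => fourier (-n) x • (a m * fourier m x)) (fun m => ?_) ?_
  · have h2 : fourierCoeffOn Real.two_pi_pos F n =
        ∫ x, ∑' m, fourier (-n) x • (a m * fourier m x)
          ∂(AddCircle.haarAddCircle (T := 2 * Real.pi - 0)) := by
      rw [fourierCoeffOn, fourierCoeff]
      refine MeasureTheory.integral_congr_ae (.of_forall fun x => ?_)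
      exact ((hG x).const_smul (fourier (-n) x)).tsum_eq.symm
    rw [← h2] at h
    refine h.unique ?_
    have h3 : ∀ m, ∫ x, fourier (-n) x • (a m * fourier m x)
        ∂(AddCircle.haarAddCircle (T := 2 * Real.pi - 0)) = a m * (Pi.single m 1 : ℤ → ℂ) n := by
      intro m
      rw [← fourierCoeff_fourier (T := 2 * Real.pi - 0) m, ← fourierCoeff.const_mul]
      rfl
    rw [funext h3]
    have h4 := hasSum_single (f := fun m => a m * (Pi.single m 1 : ℤ → ℂ) n) n
      fun m hm => by simp [hm.symm]
    simpa using h4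
  · exact (Continuous.integrable_of_hasCompactSupport (by fun_prop)
      (HasCompactSupport.of_compactSpace _))
  · simpa [fourier_norm, Circle.norm_coe] using ha

theorem norm_fourierCoeffOn_le {f : ℝ → ℂ} {C : ℝ} (hf : ∀ p, ‖f p‖ ≤ C) (n : ℤ) :
    ‖fourierCoeffOn Real.two_pi_pos f n‖ ≤ C := by
  have : Fact (0 < 2 * Real.pi - 0) := ⟨by simpa using Real.two_pi_pos⟩
  rw [fourierCoeffOn, fourierCoeff]
  refine (MeasureTheory.norm_integral_le_of_norm_le_const (C := C) (.of_forall fun x => ?_)).trans ?_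
  · rw [norm_smul, fourier_apply, Circle.norm_coe, one_mul, AddCircle.liftIoc]
    exact hf _
  · simp

/-- Integration by parts; periodicity kills the boundary term. -/
theorem fourierCoeffOn_eq_deriv {f f' : ℝ → ℂ} (hf : ∀ p, HasDerivAt f (f' p) p)
    (hc : Continuous f') (hper : Function.Periodic f (2 * Real.pi)) {n : ℤ} (hn : n ≠ 0) :
    fourierCoeffOn Real.two_pi_pos f n = 1 / (I * n) * fourierCoeffOn Real.two_pi_pos f' n := by
  rw [fourierCoeffOn_of_hasDerivAt Real.two_pi_pos hn (fun x _ => hf x)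
    (hc.intervalIntegrable _ _)]
  have h0 : f (2 * Real.pi) = f 0 := by simpa using hper 0
  have hpi : (Real.pi : ℂ) ≠ 0 := by exact_mod_cast Real.pi_ne_zero
  have hn' : (n : ℂ) ≠ 0 := by exact_mod_cast hn
  rw [h0]
  push_cast
  field_simp
  ring

/-- The constant bounding the Wiener norm of a periodic `C²` function by a common sup bound for
the function and its second derivative. -/
noncomputable def smoothConst : ℝ := 1 + ∑' n : ℤ, 1 / (n : ℝ) ^ 2

/-- Two integrations by parts give coefficients of size at most `C / n²`, and the sup bound on `f`
handles `n = 0`. Linearity of the bound in `C` is what the later summation over powers needs. -/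
theorem WienerBound.of_hasDerivAt {f f' f'' : ℝ → ℂ} {C : ℝ} (hf : ∀ p, HasDerivAt f (f' p) p)
    (hf' : ∀ p, HasDerivAt f' (f'' p) p) (hc : Continuous f'')
    (hper : Function.Periodic f (2 * Real.pi)) (hper' : Function.Periodic f' (2 * Real.pi))
    (hC : ∀ p, ‖f p‖ ≤ C) (hC'' : ∀ p, ‖f'' p‖ ≤ C) : WienerBound f (smoothConst * C) := by
  have : Fact (0 < 2 * Real.pi - 0) := ⟨by simpa using Real.two_pi_pos⟩
  have hcf : Continuous f := continuous_iff_continuousAt.2 fun p => (hf p).continuousAt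
  have hcf' : Continuous f' := continuous_iff_continuousAt.2 fun p => (hf' p).continuousAt
  set a := fourierCoeffOn Real.two_pi_pos f with ha
  have hsq : Summable fun n : ℤ => 1 / (n : ℝ) ^ 2 := Real.summable_one_div_int_pow.2 one_lt_two
  have hone : HasSum (fun n : ℤ => (Pi.single 0 1 : ℤ → ℝ) n) 1 := by
    have := hasSum_single (f := fun n : ℤ => (Pi.single 0 1 : ℤ → ℝ) n) 0
      fun n hn => by simp [hn]
    simpa using this
  have hC0 : 0 ≤ C := (norm_nonneg _).trans (hC 0)
  -- At `n = 0` the term `1 / n ^ 2` is `0` by convention, so `Pi.single 0 1` supplies the whole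
  -- bound there.
  have hle : ∀ n : ℤ, ‖a n‖ ≤ ((Pi.single 0 1 : ℤ → ℝ) n + 1 / (n : ℝ) ^ 2) * C := by
    intro n
    rcases eq_or_ne n 0 with rfl | hn
    · simpa using norm_fourierCoeffOn_le hC 0
    · rw [ha, fourierCoeffOn_eq_deriv hf hcf' hper hn, fourierCoeffOn_eq_deriv hf' hc hper' hn]
      have h := norm_fourierCoeffOn_le hC'' n
      have h2 : ‖(1 / (I * n) : ℂ)‖ * ‖(1 / (I * n) : ℂ)‖ = 1 / (n : ℝ) ^ 2 := by
        simp only [norm_div, norm_mul, norm_one, norm_I, one_mul, Complex.norm_intCast]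
        rw [← sq, div_pow, sq_abs, one_pow]
      rw [norm_mul, norm_mul, ← mul_assoc, h2, Pi.single_eq_of_ne hn, zero_add]
      gcongr
  have hsum := ((hone.add hsq.hasSum).mul_right C)
  have hsa : Summable fun n => ‖a n‖ :=
    Summable.of_nonneg_of_le (fun _ => norm_nonneg _) hle hsum.summable
  refine ⟨a, hsa, hasSum_le hle hsa.hasSum hsum, fun p => ?_⟩
  have hper0 : Function.Periodic f (2 * Real.pi - 0) := by simpa using hper
  -- Pointwise convergence needs a continuous function on the circle. Periodicity gives one by
  -- descent, and it agrees with the `liftIoc` used to define the coefficients.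
  let g : C(AddCircle (2 * Real.pi - 0), ℂ) :=
    ⟨hper0.lift, continuous_coinduced_dom.2 (by exact hcf)⟩
  have hg : ⇑g = AddCircle.liftIoc (2 * Real.pi - 0) 0 f := by
    funext x
    obtain ⟨y, hy, rfl⟩ : ∃ y ∈ Set.Ioc (0 : ℝ) (0 + (2 * Real.pi - 0)), (y : AddCircle _) = x :=
      ⟨AddCircle.equivIoc _ 0 x, (AddCircle.equivIoc _ 0 x).2,
        (AddCircle.equivIoc _ 0).symm_apply_apply x⟩
    rw [AddCircle.liftIoc_coe_apply hy]
    exact hper0.lift_coe y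
  have hga : fourierCoeff g = a := by rw [hg]; rfl
  have h := has_pointwise_sum_fourier_series_of_summable (f := g) (by rw [hga]; exact hsa.of_norm)
    (p : AddCircle (2 * Real.pi - 0))
  rw [hga, show g (p : AddCircle (2 * Real.pi - 0)) = f p from hper0.lift_coe p] at h
  simpa only [fourier_coe_eq_circleChar, smul_eq_mul] using h

/-- The explicit dependence on `s` is the point: `m ^ (-s)` times a quadratic polynomial in `s`,
hence purely geometric growth up to a polynomial factor. The summand `1` covers the function itself,
the other two cover its second derivative. -/
theorem WienerBound.rpow_neg {P P' P'' : ℝ → ℝ} {m M s : ℝ} (hm : 0 < m) (hs : 0 ≤ s)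
    (hP : ∀ p, HasDerivAt P (P' p) p) (hP' : ∀ p, HasDerivAt P' (P'' p) p)
    (hc : Continuous P'') (hper : Function.Periodic P (2 * Real.pi))
    (hper' : Function.Periodic P' (2 * Real.pi)) (hmP : ∀ p, m ≤ P p)
    (hM' : ∀ p, |P' p| ≤ M) (hM'' : ∀ p, |P'' p| ≤ M) :
    WienerBound (fun p => ((P p ^ (-s) : ℝ) : ℂ))
      (smoothConst * (m ^ (-s) * (1 + s * (s + 1) * (M / m) ^ 2 + s * (M / m)))) := by
  have hpos : ∀ p, 0 < P p := fun p => hm.trans_le (hmP p)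
  have hM : 0 ≤ M := (abs_nonneg _).trans (hM' 0)
  have hle : ∀ p (t : ℝ), 0 ≤ t → P p ^ (-t) ≤ m ^ (-t) := fun p t ht =>
    Real.rpow_le_rpow_of_nonpos hm (hmP p) (by linarith)
  have h1 : ∀ p, HasDerivAt (fun p => P p ^ (-s)) (P' p * (-s) * P p ^ (-s - 1)) p := fun p =>
    (hP p).rpow_const (Or.inl (hpos p).ne')
  have h2 : ∀ p, HasDerivAt (fun p => P' p * (-s) * P p ^ (-s - 1))
      (P'' p * (-s) * P p ^ (-s - 1) + P' p * (-s) * (P' p * (-s - 1) * P p ^ (-s - 1 - 1))) p :=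
    fun p => ((hP' p).mul_const (-s)).mul ((hP p).rpow_const (Or.inl (hpos p).ne'))
  have hcP : Continuous P := continuous_iff_continuousAt.2 fun p => (hP p).continuousAt
  have hcP' : Continuous P' := continuous_iff_continuousAt.2 fun p => (hP' p).continuousAt
  have hcr : ∀ t : ℝ, Continuous fun p => P p ^ t := fun t =>
    hcP.rpow_const fun p => Or.inl (hpos p).ne'
  have e1 : m ^ (-(s + 1)) = m ^ (-s) / m := by
    rw [neg_add, ← sub_eq_add_neg, Real.rpow_sub_one hm.ne']
  have e2 : m ^ (-(s + 2)) = m ^ (-s) / m ^ 2 := by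
    rw [neg_add, ← sub_eq_add_neg, Real.rpow_sub hm, Real.rpow_two]
  have hms : 0 < m ^ (-s) := Real.rpow_pos_of_pos hm _
  refine WienerBound.of_hasDerivAt (fun p => (h1 p).ofReal_comp) (fun p => (h2 p).ofReal_comp)
    ?_ ?_ ?_ ?_ ?_
  · have := hcr (-s - 1)
    have := hcr (-s - 1 - 1)
    fun_prop
  · intro p; simp only [hper p]
  · intro p; simp only [hper p, hper' p]
  · intro p
    rw [Complex.norm_real, Real.norm_eq_abs, abs_of_nonneg (Real.rpow_nonneg (hpos p).le _)]
    refine (hle p s hs).trans ?_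
    have : 0 ≤ s * (s + 1) * (M / m) ^ 2 + s * (M / m) := by positivity
    nlinarith
  · intro p
    rw [Complex.norm_real, Real.norm_eq_abs]
    have a1 := hle p (s + 1) (by linarith)
    have a2 := hle p (s + 2) (by linarith)
    rw [e1] at a1
    rw [e2] at a2
    have b1 : -s - 1 = -(s + 1) := by ring
    have b2 : -(s + 1) - 1 = -(s + 2) := by ring
    rw [b1, b2]
    have r1 := Real.rpow_nonneg (hpos p).le (-(s + 1))
    have r2 := Real.rpow_nonneg (hpos p).le (-(s + 2))
    calc _ ≤ |P'' p * (-s) * P p ^ (-(s + 1))| +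
          |P' p * (-s) * (P' p * (-(s + 1)) * P p ^ (-(s + 2)))| := abs_add_le _ _
      _ = |P'' p| * s * P p ^ (-(s + 1)) + s * (s + 1) * (|P' p| * |P' p|) * P p ^ (-(s + 2)) := by
        simp only [abs_mul, abs_neg, abs_of_nonneg hs, abs_of_nonneg (by linarith : 0 ≤ s + 1),
          abs_of_nonneg r1, abs_of_nonneg r2]
        ring
      _ ≤ M * s * (m ^ (-s) / m) + s * (s + 1) * (M * M) * (m ^ (-s) / m ^ 2) := by
        gcongr
        · exact hM'' p
        · exact hM' p
        · exact hM' p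
      _ ≤ _ := by
        have : M * s * (m ^ (-s) / m) + s * (s + 1) * (M * M) * (m ^ (-s) / m ^ 2) =
          m ^ (-s) * (s * (s + 1) * (M / m) ^ 2 + s * (M / m)) := by field_simp; ring
        rw [this]
        gcongr
        linarith

/-! ### Binomial series -/

theorem hasSum_choose_mul_pow (s : ℝ) {x : ℝ} (hx : |x| < 1) :
    HasSum (fun n : ℕ => Ring.choose s n * x ^ n) ((1 + x) ^ s) := by
  have h := (Real.one_add_rpow_hasFPowerSeriesOnBall_zero (a := s)).hasSum
    (y := x) (by simpa [Metric.mem_eball, edist_dist, Real.dist_eq] using hx)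
  simpa only [binomialSeries_apply, List.ofFn_const, List.prod_replicate, smul_eq_mul, zero_add]
    using h

/-- The binomial series converges at `2/3`, so its terms there are bounded. Any growth rate in `(1,
2)` would do: it will be multiplied by a ratio `1/2`. -/
theorem exists_abs_choose_le (s : ℝ) : ∃ D, ∀ n : ℕ, |Ring.choose s n| ≤ D * (3 / 2) ^ n := by
  have h := (hasSum_choose_mul_pow s (x := 2 / 3) (by norm_num [abs_of_pos])).summable
  obtain ⟨D, hD⟩ := (h.tendsto_atTop_zero.norm.bddAbove_range)
  refine ⟨D, fun n => ?_⟩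
  have h1 : |Ring.choose s n| * (2 / 3) ^ n ≤ D := by
    simpa [abs_mul, abs_of_pos] using hD ⟨n, rfl⟩
  calc |Ring.choose s n| = |Ring.choose s n| * (2 / 3) ^ n * (3 / 2) ^ n := by
        rw [mul_assoc, ← mul_pow]; norm_num
    _ ≤ _ := by gcongr

/-! ### Trigonometric approximation and the Wiener–Lévy theorem -/

/-- The real part of a trigonometric polynomial. -/
noncomputable def reTrigPoly (s : Finset ℤ) (c : ℤ → ℂ) (p : ℝ) : ℝ :=
  (∑ n ∈ s, c n * circleChar p n).re

theorem hasDerivAt_reTrigPoly (s : Finset ℤ) (c : ℤ → ℂ) (p : ℝ) :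
    HasDerivAt (reTrigPoly s c) (reTrigPoly s (fun n => c n * (I * n)) p) p := by
  have h : HasDerivAt (fun p => ∑ n ∈ s, c n * circleChar p n)
      (∑ n ∈ s, c n * (I * n * circleChar p n)) p :=
    HasDerivAt.fun_sum fun n _ => (hasDerivAt_circleChar n p).const_mul (c n)
  refine (Complex.reCLM.hasFDerivAt.comp_hasDerivAt p h).congr_deriv ?_
  simp only [reTrigPoly, mul_assoc, reCLM_apply]

theorem reTrigPoly_periodic (s : Finset ℤ) (c : ℤ → ℂ) :
    Function.Periodic (reTrigPoly s c) (2 * Real.pi) := fun p => by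
  unfold reTrigPoly
  congr 1
  exact Finset.sum_congr rfl fun n _ => congrArg (c n * ·) (circleChar_periodic n p)

theorem abs_reTrigPoly_le (s : Finset ℤ) (c : ℤ → ℂ) (p : ℝ) :
    |reTrigPoly s c p| ≤ ∑ n ∈ s, ‖c n‖ := by
  refine (Complex.abs_re_le_norm _).trans ((norm_sum_le _ _).trans (le_of_eq ?_))
  simp [norm_circleChar]

theorem continuous_reTrigPoly (s : Finset ℤ) (c : ℤ → ℂ) : Continuous (reTrigPoly s c) :=
  continuous_iff_continuousAt.2 fun p => (hasDerivAt_reTrigPoly s c p).continuousAt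

theorem exists_pos_le_of_periodic {F : ℝ → ℝ} (hc : Continuous F)
    (hper : Function.Periodic F (2 * Real.pi)) (hpos : ∀ p, 0 < F p) : ∃ δ > 0, ∀ p, δ ≤ F p := by
  obtain ⟨q, -, hq⟩ := (isCompact_Icc (a := (0 : ℝ)) (b := 2 * Real.pi)).exists_isMinOn
    ⟨0, by simp [Real.pi_pos.le]⟩ hc.continuousOn
  refine ⟨F q, hpos q, fun p => ?_⟩
  obtain ⟨y, hy, hy'⟩ := hper.exists_mem_Ico₀ Real.two_pi_pos p
  rw [hy']
  exact hq (Set.Ico_subset_Icc_self hy)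

/-- A real Wiener function is, up to arbitrarily small Wiener norm, the real part of a
trigonometric polynomial. -/
theorem exists_reTrigPoly_wienerBound_sub {a : ℤ → ℂ} (ha : Summable fun n => ‖a n‖) {F : ℝ → ℝ}
    (hF : ∀ p, HasSum (fun n => a n * circleChar p n) (F p : ℂ)) {ε : ℝ} (hε : 0 < ε) :
    ∃ s : Finset ℤ, WienerBound (fun p => ((F p - reTrigPoly s a p : ℝ) : ℂ)) ε := by
  obtain ⟨s, hs⟩ := ((tendsto_tsum_compl_atTop_zero fun n => ‖a n‖).eventually
    (ge_mem_nhds hε)).exists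
  refine ⟨s, ?_⟩
  have hb : WienerBound (fun p => (F p : ℂ) - ∑ n ∈ s, a n * circleChar p n) ε := by
    -- The error is the tail of the series, whose Wiener norm is at most `ε` by the choice of `s`;
    -- taking real parts afterwards does not increase it.
    refine ⟨Set.indicator {n | n ∉ s} a, ?_, ?_, fun p => ?_⟩
    · simpa only [norm_indicator_eq_indicator_norm] using ha.indicator {n | n ∉ s}
    · simp only [norm_indicator_eq_indicator_norm]
      rw [← tsum_subtype]
      exact hs
    · have h := (hF p).sub (hasSum_sum_of_ne_finset_zero (s := s)
        (f := fun n => if n ∈ s then a n * circleChar p n else 0) fun n hn => by simp [hn])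
      have e : ∑ n ∈ s, (if n ∈ s then a n * circleChar p n else 0) =
          ∑ n ∈ s, a n * circleChar p n := Finset.sum_congr rfl fun n hn => by simp [hn]
      rw [e] at h
      refine h.congr_fun fun n => ?_
      by_cases hn : n ∈ s <;> simp [hn, Set.indicator]
  simpa [reTrigPoly] using hb.re

/-- **Wiener–Lévy theorem** for negative powers of a positive function. -/
theorem exists_wienerBound_rpow {a : ℤ → ℂ} (ha : Summable fun n => ‖a n‖) {F : ℝ → ℝ}
    (hF : ∀ p, HasSum (fun n => a n * circleChar p n) (F p : ℂ)) (hpos : ∀ p, 0 < F p)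
    {t : ℝ} (ht : 0 ≤ t) : ∃ C, WienerBound (fun p => ((F p ^ (-t) : ℝ) : ℂ)) C := by
  have hW : WienerBound (fun p => (F p : ℂ)) (∑' n, ‖a n‖) := ⟨a, ha, le_rfl, hF⟩
  have hcont : Continuous F := Complex.continuous_re.comp hW.continuous
  have hper : Function.Periodic F (2 * Real.pi) := fun p => by
    simpa using congrArg Complex.re (hW.periodic p)
  obtain ⟨δ, hδ, hδF⟩ := exists_pos_le_of_periodic hcont hper hpos
  -- With error `δ / 3` one has `P ≥ 2δ / 3 = m`, so the error over `m` is `1/2`. Against the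
  -- binomial growth `3/2` this leaves the ratio `3/4`.
  obtain ⟨s, hs⟩ := exists_reTrigPoly_wienerBound_sub ha hF (ε := δ / 3) (by positivity)
  obtain ⟨D, hD⟩ := exists_abs_choose_le (-t)
  set P := reTrigPoly s a with hPdef
  set m := 2 * δ / 3 with hm
  have hm0 : 0 < m := by positivity
  have hh : ∀ p, |F p - P p| ≤ δ / 3 := fun p => by
    simpa only [Complex.norm_real, Real.norm_eq_abs] using hs.norm_le p
  have hmP : ∀ p, m ≤ P p := fun p => by
    have := (abs_le.1 (hh p)).2
    have := hδF p
    rw [hm]; linarith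
  set c' : ℤ → ℂ := fun n => a n * (I * n)
  set c'' : ℤ → ℂ := fun n => c' n * (I * n)
  obtain ⟨M, hM', hM''⟩ : ∃ M, (∀ p, |reTrigPoly s c' p| ≤ M) ∧ ∀ p, |reTrigPoly s c'' p| ≤ M :=
    ⟨max (∑ n ∈ s, ‖c' n‖) (∑ n ∈ s, ‖c'' n‖),
      fun p => (abs_reTrigPoly_le s c' p).trans (le_max_left _ _),
      fun p => (abs_reTrigPoly_le s c'' p).trans (le_max_right _ _)⟩
  have hpow : ∀ n : ℕ, WienerBound (fun p => ((P p ^ (-(t + n)) : ℝ) : ℂ)) (smoothConst *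
      (m ^ (-(t + n)) * (1 + (t + n) * ((t + n) + 1) * (M / m) ^ 2 + (t + n) * (M / m)))) :=
    fun n => WienerBound.rpow_neg hm0 (by positivity) (hasDerivAt_reTrigPoly s a)
      (hasDerivAt_reTrigPoly s c') (continuous_reTrigPoly s c'') (reTrigPoly_periodic s a)
      (reTrigPoly_periodic s c') hmP hM' hM''
  have hterm : ∀ n : ℕ, WienerBound (fun p =>
      ((Ring.choose (-t) n * (F p - P p) ^ n * P p ^ (-(t + n)) : ℝ) : ℂ))
      (|Ring.choose (-t) n| * (δ / 3) ^ n * (smoothConst *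
      (m ^ (-(t + n)) * (1 + (t + n) * ((t + n) + 1) * (M / m) ^ 2 + (t + n) * (M / m))))) := by
    intro n
    have h := ((WienerBound.const ((Ring.choose (-t) n : ℝ) : ℂ)).mul (hs.pow n)).mul (hpow n)
    rw [Complex.norm_real, Real.norm_eq_abs] at h
    simpa only [Complex.ofReal_mul, Complex.ofReal_pow] using h
  refine WienerBound.of_hasSum hterm ?_ (fun p => ?_)
  · have hM0 : 0 ≤ M := (abs_nonneg _).trans (hM' 0)
    have hK : 0 ≤ smoothConst := by
      unfold smoothConst
      have : 0 ≤ ∑' n : ℤ, 1 / (n : ℝ) ^ 2 := tsum_nonneg fun _ => by positivity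
      linarith
    have hsum : Summable fun n : ℕ => D * (smoothConst * m ^ (-t)) *
        ((1 + t * (t + 1) * (M / m) ^ 2 + t * (M / m)) * ((n : ℝ) ^ 0 * (3 / 4) ^ n) +
          ((2 * t + 1) * (M / m) ^ 2 + M / m) * ((n : ℝ) ^ 1 * (3 / 4) ^ n) +
          (M / m) ^ 2 * ((n : ℝ) ^ 2 * (3 / 4) ^ n)) := by
      have hg : ∀ k : ℕ, Summable fun n : ℕ => (n : ℝ) ^ k * (3 / 4 : ℝ) ^ n := fun k =>
        summable_pow_mul_geometric_of_norm_lt_one k (by norm_num)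
      exact ((((hg 0).mul_left _).add ((hg 1).mul_left _)).add ((hg 2).mul_left _)).mul_left _
    refine Summable.of_nonneg_of_le (fun n => by positivity) (fun n => ?_) hsum
    have em : m ^ (-(t + n)) = m ^ (-t) * (m⁻¹) ^ n := by
      rw [neg_add, Real.rpow_add hm0, Real.rpow_neg hm0.le (n : ℝ), Real.rpow_natCast, inv_pow]
    rw [em]
    calc _ ≤ D * (3 / 2) ^ n * (δ / 3) ^ n * (smoothConst * (m ^ (-t) * (m⁻¹) ^ n *
          (1 + (t + n) * ((t + n) + 1) * (M / m) ^ 2 + (t + n) * (M / m)))) := by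
          gcongr
          exact hD n
      _ = D * (smoothConst * m ^ (-t)) * ((1 + (t + n) * ((t + n) + 1) * (M / m) ^ 2 +
          (t + n) * (M / m)) * ((3 / 2) ^ n * (δ / 3) ^ n * (m⁻¹) ^ n)) := by ring
      _ = D * (smoothConst * m ^ (-t)) * ((1 + (t + n) * ((t + n) + 1) * (M / m) ^ 2 +
          (t + n) * (M / m)) * (3 / 4) ^ n) := by
          rw [← mul_pow, ← mul_pow, show 3 / 2 * (δ / 3) * m⁻¹ = 3 / 4 by rw [hm]; field_simp; norm_num]
      _ ≤ _ := le_of_eq (by ring)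
  -- Pointwise, `F = P (1 + (F - P) / P)` with `|(F - P) / P| < 1`, so the binomial series applies.
  · have hP0 : 0 < P p := hm0.trans_le (hmP p)
    have hx : |(F p - P p) / P p| < 1 := by
      rw [abs_div, abs_of_pos hP0, div_lt_one hP0]
      have := hh p
      have := hmP p
      rw [hm] at this
      linarith
    have h := (hasSum_choose_mul_pow (-t) hx).mul_right (P p ^ (-t))
    have e : (1 + (F p - P p) / P p) ^ (-t) * P p ^ (-t) = F p ^ (-t) := by
      rw [← Real.mul_rpow (by linarith [(abs_lt.1 hx).1]) hP0.le]
      congr 1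
      field_simp
      ring
    rw [e] at h
    refine Complex.hasSum_ofReal.2 (h.congr_fun fun n => ?_)
    rw [neg_add, Real.rpow_add hP0, Real.rpow_neg hP0.le (n : ℝ), Real.rpow_natCast, div_pow]
    field_simp

/-! ### From Fourier coefficients to a functional calculus -/

theorem WienerBound.summable_fourierCoeffOn {F : ℝ → ℂ} {C : ℝ} (hF : WienerBound F C) :
    Summable fun n => ‖fourierCoeffOn Real.two_pi_pos F n‖ := by
  obtain ⟨a, ha, -, hF⟩ := hF
  rwa [fourierCoeffOn_eq_of_hasSum ha hF]

theorem WienerBound.hasSum_fourierCoeffOn {F : ℝ → ℂ} {C : ℝ} (hF : WienerBound F C) (p : ℝ) :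
    HasSum (fun n => fourierCoeffOn Real.two_pi_pos F n * circleChar p n) (F p) := by
  obtain ⟨a, ha, -, hF⟩ := hF
  rw [fourierCoeffOn_eq_of_hasSum ha hF]
  exact hF p

theorem seqConv_fourierCoeffOn {F G : ℝ → ℂ} {C D : ℝ} (hF : WienerBound F C)
    (hG : WienerBound G D) :
    seqConv (fourierCoeffOn Real.two_pi_pos F) (fourierCoeffOn Real.two_pi_pos G) =
      fourierCoeffOn Real.two_pi_pos fun p => F p * G p :=
  (fourierCoeffOn_eq_of_hasSum
    (summable_norm_seqConv hF.summable_fourierCoeffOn hG.summable_fourierCoeffOn) fun p =>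
      hasSum_seqConv_smul hF.summable_fourierCoeffOn hG.summable_fourierCoeffOn (circleChar_add p)
        (fun n => (norm_circleChar p n).le) (hF.hasSum_fourierCoeffOn p)
        (hG.hasSum_fourierCoeffOn p)).symm

theorem fourierCoeffOn_const_one :
    fourierCoeffOn Real.two_pi_pos (fun _ => (1 : ℂ)) = Pi.single 0 1 := by
  have hs : ∀ n : ℤ, n ≠ 0 → (Pi.single 0 1 : ℤ → ℂ) n = 0 := fun n hn => by simp [hn]
  refine fourierCoeffOn_eq_of_hasSum (summable_of_ne_finset_zero (s := {0}) fun n hn => ?_)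
    fun p => ?_
  · rw [hs n (by simpa using hn), norm_zero]
  · simpa [circleChar_zero] using
      hasSum_single (f := fun n => (Pi.single 0 1 : ℤ → ℂ) n * circleChar p n) 0
        fun n hn => by rw [hs n hn, zero_mul]

theorem conj_fourierCoeffOn {F : ℝ → ℝ} {C : ℝ} (hF : WienerBound (fun p => (F p : ℂ)) C)
    (n : ℤ) : (starRingEnd ℂ) (fourierCoeffOn Real.two_pi_pos (fun p => (F p : ℂ)) n) =
      fourierCoeffOn Real.two_pi_pos (fun p => (F p : ℂ)) (-n) := by
  set a := fourierCoeffOn Real.two_pi_pos fun p => (F p : ℂ) with ha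
  have h : fourierCoeffOn Real.two_pi_pos (fun p => (F p : ℂ)) =
      fun n => (starRingEnd ℂ) (a (-n)) := by
    refine fourierCoeffOn_eq_of_hasSum ?_ fun p => ?_
    · simpa [Function.comp_def] using (Equiv.neg ℤ).summable_iff.2 hF.summable_fourierCoeffOn
    · have h := (Equiv.neg ℤ).hasSum_iff.2 (Complex.hasSum_conj'.2 (hF.hasSum_fourierCoeffOn p))
      simpa [Function.comp_def, conj_circleChar] using h
  rw [← ha] at h
  conv_rhs => rw [h]
  simp

/-- Trigonometric series with pointwise reciprocal sums give mutually inverse elements when the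
characters are replaced by the powers of an invertible element. -/
theorem mul_eq_one_of_fourierCoeffOn {B : Type*} [NormedRing B] [NormedAlgebra ℂ B]
    [CompleteSpace B] {u : ℤ → B} (hu0 : u 0 = 1) (hu : ∀ m n, u (m + n) = u m * u n)
    (hu1 : ∀ n, ‖u n‖ ≤ 1) {F G : ℝ → ℂ} {C D : ℝ} (hF : WienerBound F C) (hG : WienerBound G D)
    (hFG : ∀ p, F p * G p = 1) {x y : B}
    (hx : HasSum (fun n => fourierCoeffOn Real.two_pi_pos F n • u n) x)
    (hy : HasSum (fun n => fourierCoeffOn Real.two_pi_pos G n • u n) y) : x * y = 1 := by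
  have h := hasSum_seqConv_smul hF.summable_fourierCoeffOn hG.summable_fourierCoeffOn hu hu1 hx hy
  rw [seqConv_fourierCoeffOn hF hG, funext hFG, fourierCoeffOn_const_one] at h
  refine h.unique ?_
  have h1 := hasSum_single (f := fun n => (Pi.single 0 1 : ℤ → ℂ) n • u n) 0
    fun n hn => by simp [hn]
  simpa [hu0] using h1

/-! ### Powers of the unitary operator and positivity of the symbol -/

namespace UnitaryOrbit

variable {H : Type*} [NormedAddCommGroup H] [InnerProductSpace ℂ H] [CompleteSpace H]

theorem norm_zpow_apply (A : unitary (H →L[ℂ] H)) (k : ℤ) (x : H) :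
    ‖((A ^ k : unitary (H →L[ℂ] H)) : H →L[ℂ] H) x‖ = ‖x‖ :=
  ContinuousLinearMap.norm_map_of_mem_unitary (A ^ k).2 x

theorem norm_zpow_le_one (A : unitary (H →L[ℂ] H)) (k : ℤ) :
    ‖((A ^ k : unitary (H →L[ℂ] H)) : H →L[ℂ] H)‖ ≤ 1 :=
  ContinuousLinearMap.opNorm_le_bound _ zero_le_one fun x => by rw [norm_zpow_apply, one_mul]

theorem coe_zpow_add (A : unitary (H →L[ℂ] H)) (m n : ℤ) :
    ((A ^ (m + n) : unitary (H →L[ℂ] H)) : H →L[ℂ] H) =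
      ((A ^ m : unitary (H →L[ℂ] H)) : H →L[ℂ] H) * ((A ^ n : unitary (H →L[ℂ] H)) : H →L[ℂ] H) := by
  rw [zpow_add]; rfl

theorem coe_zpow_zero (A : unitary (H →L[ℂ] H)) :
    ((A ^ (0 : ℤ) : unitary (H →L[ℂ] H)) : H →L[ℂ] H) = 1 := by simp

theorem star_coe_zpow (A : unitary (H →L[ℂ] H)) (k : ℤ) :
    star ((A ^ k : unitary (H →L[ℂ] H)) : H →L[ℂ] H) =
      ((A ^ (-k) : unitary (H →L[ℂ] H)) : H →L[ℂ] H) := by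
  rw [zpow_neg, ← Unitary.star_eq_inv, Unitary.coe_star]

theorem inner_star_left (T : H →L[ℂ] H) (x y : H) :
    inner ℂ (star T x) y = inner ℂ x (T y) := by
  rw [ContinuousLinearMap.star_eq_adjoint, ContinuousLinearMap.adjoint_inner_left]

theorem inner_zpow_left (A : unitary (H →L[ℂ] H)) (k : ℤ) (x y : H) :
    inner ℂ (((A ^ k : unitary (H →L[ℂ] H)) : H →L[ℂ] H) x) y =
      inner ℂ x (((A ^ (-k) : unitary (H →L[ℂ] H)) : H →L[ℂ] H) y) := by
  rw [← inner_star_left, star_coe_zpow, neg_neg]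

theorem orbit_zpow (A : unitary (H →L[ℂ] H)) (k l : ℤ) (x : H) :
    ((A ^ k : unitary (H →L[ℂ] H)) : H →L[ℂ] H) (orbit A x l) = orbit A x (k + l) := by
  rw [orbit, orbit, coe_zpow_add]; rfl

theorem orbit_zero (A : unitary (H →L[ℂ] H)) (x : H) : orbit A x 0 = x := by simp [orbit]

theorem conj_overlap (A : unitary (H →L[ℂ] H)) (f₀ : H) (j : ℤ) :
    (starRingEnd ℂ) (overlap A f₀ j) = overlap A f₀ (-j) := by
  rw [overlap, inner_conj_symm, overlap, orbit, orbit, inner_zpow_left, neg_neg]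

section

variable {A : unitary (H →L[ℂ] H)} {f₀ : H} (ha : Summable fun j : ℤ => ‖overlap A f₀ j‖)
include ha

theorem hasSum_symbol (p : ℝ) :
    HasSum (fun l => overlap A f₀ l * circleChar p l) (symbol A f₀ p) :=
  (Summable.of_norm (by simpa [norm_circleChar] using ha)).hasSum

theorem wienerBound_symbol : WienerBound (symbol A f₀) (∑' j, ‖overlap A f₀ j‖) :=
  ⟨overlap A f₀, ha, le_rfl, hasSum_symbol ha⟩

theorem fourierCoeffOn_symbol : fourierCoeffOn Real.two_pi_pos (symbol A f₀) = overlap A f₀ :=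
  fourierCoeffOn_eq_of_hasSum ha (hasSum_symbol ha)

theorem symbol_im (p : ℝ) : (symbol A f₀ p).im = 0 := by
  rw [← Complex.conj_eq_iff_im]
  have h := (Equiv.neg ℤ).hasSum_iff.2 (Complex.hasSum_conj'.2 (hasSum_symbol ha p))
  refine HasSum.unique ?_ (hasSum_symbol ha p)
  simpa [Function.comp_def, conj_circleChar, conj_overlap] using h

theorem ofReal_symbol_re (p : ℝ) : ((symbol A f₀ p).re : ℂ) = symbol A f₀ p :=
  Complex.ext rfl (symbol_im ha p).symm

/-- A nonpositive value would, by the intermediate value theorem and nonvanishing, make the symbol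
negative everywhere; but its mean is `a_0 = ‖f₀‖²`. -/
theorem symbol_re_pos (hα : ∀ p ∈ Set.Ico (0 : ℝ) (2 * Real.pi), symbol A f₀ p ≠ 0) (p : ℝ) :
    0 < (symbol A f₀ p).re := by
  have hW := wienerBound_symbol ha
  have hcont : Continuous fun p => (symbol A f₀ p).re := Complex.continuous_re.comp hW.continuous
  have hne : ∀ p, (symbol A f₀ p).re ≠ 0 := fun p h => by
    obtain ⟨q, hq, hpq⟩ := hW.periodic.exists_mem_Ico₀ Real.two_pi_pos p
    exact hα q hq (by rw [← hpq, ← ofReal_symbol_re ha, h, ofReal_zero])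
  by_contra hp
  have hneg : ∀ q, (symbol A f₀ q).re < 0 := fun q => by
    by_contra hq
    obtain ⟨r, hr⟩ := mem_range_of_exists_le_of_exists_ge hcont ⟨p, not_lt.1 hp⟩ ⟨q, not_lt.1 hq⟩
    exact hne r hr
  have h0 : overlap A f₀ 0 = (‖f₀‖ : ℂ) ^ 2 := by
    rw [overlap, orbit_zero, inner_self_eq_norm_sq_to_K]; rfl
  have hint : ∫ x in (0 : ℝ)..2 * Real.pi, (symbol A f₀ x).re < 0 := by
    have h := intervalIntegral.intervalIntegral_pos_of_pos (f := fun x => -(symbol A f₀ x).re)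
      (hcont.neg.intervalIntegrable _ _) (fun x => neg_pos.2 (hneg x)) Real.two_pi_pos
    rw [intervalIntegral.integral_neg] at h
    linarith
  have h1 : fourierCoeffOn Real.two_pi_pos (symbol A f₀) 0 = (‖f₀‖ : ℂ) ^ 2 := by
    rw [fourierCoeffOn_symbol ha, h0]
  have h2 : fourierCoeffOn Real.two_pi_pos (symbol A f₀) 0 =
      ((1 / (2 * Real.pi - 0) * ∫ x in (0 : ℝ)..2 * Real.pi, (symbol A f₀ x).re : ℝ) : ℂ) := by
    rw [fourierCoeffOn_eq_integral, ofReal_mul, ← intervalIntegral.integral_ofReal]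
    simp [ofReal_symbol_re ha]
  rw [h2] at h1
  have h3 : 1 / (2 * Real.pi - 0) * ∫ x in (0 : ℝ)..2 * Real.pi, (symbol A f₀ x).re = ‖f₀‖ ^ 2 := by
    exact_mod_cast h1
  have h4 : 1 / (2 * Real.pi - 0) * ∫ x in (0 : ℝ)..2 * Real.pi, (symbol A f₀ x).re < 0 :=
    mul_neg_of_pos_of_neg (by simp [Real.pi_pos]) hint
  have := sq_nonneg ‖f₀‖
  linarith

theorem exists_wienerBound_inv_sqrt
    (hα : ∀ p ∈ Set.Ico (0 : ℝ) (2 * Real.pi), symbol A f₀ p ≠ 0) :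
    ∃ C, WienerBound (fun p => ((1 / √(symbol A f₀ p).re : ℝ) : ℂ)) C := by
  obtain ⟨C, hC⟩ := exists_wienerBound_rpow ha (F := fun p => (symbol A f₀ p).re)
    (fun p => by rw [ofReal_symbol_re ha]; exact hasSum_symbol ha p) (symbol_re_pos ha hα)
    (t := 1 / 2) (by norm_num)
  refine ⟨C, ?_⟩
  convert hC using 4 with p
  rw [Real.rpow_neg (symbol_re_pos ha hα p).le, ← Real.sqrt_eq_rpow, one_div]

theorem exists_wienerBound_sqrt
    (hα : ∀ p ∈ Set.Ico (0 : ℝ) (2 * Real.pi), symbol A f₀ p ≠ 0) :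
    ∃ C, WienerBound (fun p => ((√(symbol A f₀ p).re : ℝ) : ℂ)) C := by
  obtain ⟨C, hC⟩ := exists_wienerBound_inv_sqrt ha hα
  refine ⟨(∑' j, ‖overlap A f₀ j‖) * C, ?_⟩
  -- Writing `√α = α · (1 / √α)` reduces the positive power to the negative one.
  convert (wienerBound_symbol ha).mul hC using 2 with p
  rw [← ofReal_symbol_re ha, ← ofReal_mul, ofReal_re, mul_one_div, Real.div_sqrt]

end

/-! ### The operator `X` on `H` and on `H₁`; orthonormality and completeness -/

/-- The restrictions of the powers of `A` to the closed span of the orbit are contractions. -/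
theorem norm_zpowOn_le_one (A : unitary (H →L[ℂ] H)) (f₀ : H) (k : ℤ) : ‖zpowOn A f₀ k‖ ≤ 1 :=
  ContinuousLinearMap.opNorm_le_bound _ zero_le_one fun x => by
    rw [one_mul]; exact (norm_zpow_apply A k x).le

theorem zpowOn_add (A : unitary (H →L[ℂ] H)) (f₀ : H) (m n : ℤ) :
    zpowOn A f₀ (m + n) = zpowOn A f₀ m * zpowOn A f₀ n := by
  ext x
  change ((A ^ (m + n) : unitary (H →L[ℂ] H)) : H →L[ℂ] H) x = _
  rw [coe_zpow_add]; rfl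

theorem zpowOn_zero (A : unitary (H →L[ℂ] H)) (f₀ : H) : zpowOn A f₀ 0 = 1 := by
  ext x
  change ((A ^ (0 : ℤ) : unitary (H →L[ℂ] H)) : H →L[ℂ] H) x = _
  rw [coe_zpow_zero]; rfl

instance (A : unitary (H →L[ℂ] H)) (f₀ : H) : CompleteSpace (orbitSpan A f₀) :=
  (Submodule.isClosed_topologicalClosure _).completeSpace_coe

theorem hasSum_opX {A : unitary (H →L[ℂ] H)} {f₀ : H} (hc : Summable fun k => ‖cCoeff A f₀ k‖) :
    HasSum (fun k => cCoeff A f₀ k • ((A ^ k : unitary (H →L[ℂ] H)) : H →L[ℂ] H)) (opX A f₀) :=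
  (summable_smul_of_norm_le_one hc (norm_zpow_le_one A)).hasSum

theorem hasSum_opXOn {A : unitary (H →L[ℂ] H)} {f₀ : H}
    (hc : Summable fun k => ‖cCoeff A f₀ k‖) :
    HasSum (fun k => cCoeff A f₀ k • zpowOn A f₀ k) (opXOn A f₀) := by
  have h : HasSum (fun k => cCoeff A f₀ k • zpowOn A f₀ k)
      (∑' k, cCoeff A f₀ k • zpowOn A f₀ k) :=
    (summable_smul_of_norm_le_one (E := orbitSpan A f₀ →L[ℂ] orbitSpan A f₀) hc
      (norm_zpowOn_le_one A f₀)).hasSum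
  convert h using 1
  ext x
  have h1 := ((orbitSpan A f₀).subtypeL.comp
    (ContinuousLinearMap.apply ℂ (orbitSpan A f₀) x)).hasSum h
  have h2 := (hasSum_opX hc).mapL (ContinuousLinearMap.apply ℂ H (x : H))
  exact h2.unique h1

theorem isBoundedInverse_of_mul_eq_one {E : Type*} [NormedAddCommGroup E] [NormedSpace ℂ E]
    {T Y : E →L[ℂ] E} (h1 : Y * T = 1) (h2 : T * Y = 1) : IsBoundedInverse T Y :=
  ⟨fun x => DFunLike.congr_fun h1 x, fun x => DFunLike.congr_fun h2 x⟩

theorem IsBoundedInverse.unique {E : Type*} [NormedAddCommGroup E] [NormedSpace ℂ E]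
    {T Y Z : E →L[ℂ] E} (hY : IsBoundedInverse T Y) (hZ : IsBoundedInverse T Z) : Y = Z := by
  ext x
  rw [← hZ.2 x, hY.1, hZ.2]

theorem orthonormal_phi {A : unitary (H →L[ℂ] H)} {f₀ : H}
    (ha : Summable fun j : ℤ => ‖overlap A f₀ j‖)
    (hα : ∀ p ∈ Set.Ico (0 : ℝ) (2 * Real.pi), symbol A f₀ p ≠ 0) :
    Orthonormal ℂ (phi A f₀) := by
  obtain ⟨C, hC⟩ := exists_wienerBound_inv_sqrt ha hα
  have hc : Summable fun k => ‖cCoeff A f₀ k‖ := hC.summable_fourierCoeffOn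
  have hX := hasSum_opX hc
  have hconj : ∀ k, (starRingEnd ℂ) (cCoeff A f₀ k) = cCoeff A f₀ (-k) := conj_fourierCoeffOn hC
  -- Since `1 / √α` is real, `c_{-k}` is the conjugate of `c_k`, and `star (A ^ k) = A ^ (-k)`.
  have hstar : star (opX A f₀) = opX A f₀ := by
    have h := (Equiv.neg ℤ).hasSum_iff.2 hX.star
    refine HasSum.unique (h.congr_fun fun k => ?_) hX
    simp only [Function.comp_apply, Equiv.neg_apply, star_smul, star_coe_zpow, neg_neg]
    rw [← starRingEnd_apply, hconj, neg_neg]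
  have hC2 := hC.mul hC
  set b := fourierCoeffOn Real.two_pi_pos
    fun p => ((1 / √(symbol A f₀ p).re : ℝ) : ℂ) * ((1 / √(symbol A f₀ p).re : ℝ) : ℂ) with hb
  have hbX : HasSum (fun k => b k • ((A ^ k : unitary (H →L[ℂ] H)) : H →L[ℂ] H))
      (opX A f₀ * opX A f₀) := by
    rw [hb, ← seqConv_fourierCoeffOn hC hC]
    exact hasSum_seqConv_smul hc hc (coe_zpow_add A) (norm_zpow_le_one A) hX hX
  -- `b` holds the coefficients of `1 / α` and the overlaps are those of `α`.
  have hbα : seqConv b (overlap A f₀) = Pi.single 0 1 := by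
    rw [← fourierCoeffOn_symbol ha, hb, seqConv_fourierCoeffOn hC2 (wienerBound_symbol ha),
      ← fourierCoeffOn_const_one]
    congr 1
    funext p
    have hp := symbol_re_pos ha hα p
    rw [← ofReal_symbol_re ha, ← ofReal_mul, ← ofReal_mul, ofReal_re, div_mul_div_comm, one_mul,
      Real.mul_self_sqrt hp.le, one_div_mul_cancel hp.ne', ofReal_one]
  have key : ∀ k : ℤ, inner ℂ (phi A f₀ k) (opX A f₀ f₀) = (Pi.single 0 1 : ℤ → ℂ) k := by
    intro k
    have e1 : inner ℂ (phi A f₀ k) (opX A f₀ f₀) =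
        inner ℂ f₀ ((opX A f₀ * opX A f₀) (orbit A f₀ (-k))) := by
      have hcomm : opX A f₀ (orbit A f₀ (-k)) = orbit A (opX A f₀ f₀) (-k) := by
        have h1 := hX.mapL (ContinuousLinearMap.apply ℂ H (orbit A f₀ (-k)))
        have h2 := (hX.mapL (ContinuousLinearMap.apply ℂ H f₀)).mapL
          ((A ^ (-k) : unitary (H →L[ℂ] H)) : H →L[ℂ] H)
        refine h1.unique (h2.congr_fun fun l => ?_)
        simp only [map_smul, ContinuousLinearMap.apply_apply]
        change _ • _ = _ • ((A ^ (-k) : unitary (H →L[ℂ] H)) : H →L[ℂ] H) (orbit A f₀ l)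
        rw [orbit_zpow, orbit_zpow, add_comm]
      have hy : ∀ y, inner ℂ (opX A f₀ f₀) y = inner ℂ f₀ (opX A f₀ y) := fun y => by
        rw [← inner_star_left, hstar]
      rw [phi, orbit, inner_zpow_left, hy]
      change inner ℂ f₀ (opX A f₀ (orbit A (opX A f₀ f₀) (-k))) = _
      rw [← hcomm]
      rfl
    rw [e1, ← hbα]
    have h := (hbX.mapL (ContinuousLinearMap.apply ℂ H (orbit A f₀ (-k)))).mapL (innerSL ℂ f₀)
    refine (HasSum.tsum_eq (h.congr_fun fun l => ?_)).symm
    have e2 : overlap A f₀ (k - l) = inner ℂ f₀ (orbit A f₀ (l + -k)) := by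
      rw [overlap, orbit, inner_zpow_left, neg_sub, sub_eq_add_neg]; rfl
    rw [e2, ← orbit_zpow]
    simp only [ContinuousLinearMap.apply_apply, innerSL_apply_apply]
    exact (inner_smul_right _ _ _).symm
  rw [orthonormal_iff_ite]
  intro m n
  -- Unitarity makes the Gram matrix depend only on `m - n`.
  have e : inner ℂ (phi A f₀ m) (phi A f₀ n) = inner ℂ (phi A f₀ (-n + m)) (opX A f₀ f₀) := by
    rw [phi, phi, phi, ← orbit_zpow, inner_zpow_left, neg_neg]; rfl
  rw [e, key]
  rcases eq_or_ne m n with rfl | h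
  · simp
  · rw [Pi.single_eq_of_ne (by omega), if_neg h]

/-- Applying `A ^ n D` to `X f₀` gives `f_n = ∑ d_k φ_{n+k}`, so each orbit vector is a limit of
combinations of the `φ`. Only the identity `D X f₀ = f₀` is needed, not full invertibility. -/
theorem phiComplete_of_isBoundedInverse {A : unitary (H →L[ℂ] H)} {f₀ : H} {d : ℤ → ℂ}
    {D : H →L[ℂ] H}
    (hD : HasSum (fun k => d k • ((A ^ k : unitary (H →L[ℂ] H)) : H →L[ℂ] H)) D)
    (hDX : D (opX A f₀ f₀) = f₀) : PhiComplete A f₀ := by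
  have hf : f₀ ∈ orbitSpan A f₀ :=
    Submodule.le_topologicalClosure _ (Submodule.subset_span ⟨0, orbit_zero A f₀⟩)
  refine le_antisymm ?_ ?_
  · refine Submodule.topologicalClosure_minimal _ ?_ (Submodule.isClosed_topologicalClosure _)
    rw [Submodule.span_le]
    rintro _ ⟨n, rfl⟩
    exact zpow_mem_orbitSpan A f₀ n (opX_mem_orbitSpan A f₀ hf)
  · refine Submodule.topologicalClosure_minimal _ ?_ (Submodule.isClosed_topologicalClosure _)
    rw [Submodule.span_le]
    rintro _ ⟨n, rfl⟩
    have h := (hD.mapL (ContinuousLinearMap.apply ℂ H (opX A f₀ f₀))).mapL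
      ((A ^ n : unitary (H →L[ℂ] H)) : H →L[ℂ] H)
    simp only [ContinuousLinearMap.apply_apply, hDX] at h
    refine (Submodule.isClosed_topologicalClosure _).mem_of_tendsto h
      (Filter.Eventually.of_forall fun s => Submodule.sum_mem _ fun k _ => ?_)
    have e : ((A ^ n : unitary (H →L[ℂ] H)) : H →L[ℂ] H)
        ((d k • ((A ^ k : unitary (H →L[ℂ] H)) : H →L[ℂ] H)) (opX A f₀ f₀)) =
        d k • phi A f₀ (n + k) := by
      rw [phi, ← orbit_zpow, ← map_smul]; rfl
    rw [e]
    exact Submodule.smul_mem _ _ (Submodule.le_topologicalClosure _ (Submodule.subset_span ⟨_, rfl⟩))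

end UnitaryOrbit

theorem proposition1 {H : Type*} [NormedAddCommGroup H] [InnerProductSpace ℂ H] [CompleteSpace H]
    (A : unitary (H →L[ℂ] H)) (f₀ : H)
    (ha : Summable fun j : ℤ => ‖UnitaryOrbit.overlap A f₀ j‖)
    (hα : ∀ p ∈ Set.Ico (0 : ℝ) (2 * Real.pi), UnitaryOrbit.symbol A f₀ p ≠ 0) :
    (∀ p : ℝ, (UnitaryOrbit.symbol A f₀ p).im = 0 ∧ 0 < (UnitaryOrbit.symbol A f₀ p).re) ∧
    (Summable fun k : ℤ => ‖UnitaryOrbit.cCoeff A f₀ k‖) ∧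
    Orthonormal ℂ (UnitaryOrbit.phi A f₀) ∧
    (UnitaryOrbit.PhiComplete A f₀ ↔
      ∃ Y : H →L[ℂ] H, UnitaryOrbit.IsBoundedInverse (UnitaryOrbit.opX A f₀) Y) ∧
    (UnitaryOrbit.PhiComplete A f₀ ↔
      ∃ Y : UnitaryOrbit.orbitSpan A f₀ →L[ℂ] UnitaryOrbit.orbitSpan A f₀,
        UnitaryOrbit.IsBoundedInverse (UnitaryOrbit.opXOn A f₀) Y) ∧
    (∀ Y : H →L[ℂ] H, UnitaryOrbit.IsBoundedInverse (UnitaryOrbit.opX A f₀) Y →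
      HasSum (fun l : ℤ => UnitaryOrbit.dCoeff A f₀ l •
        ((A ^ l : unitary (H →L[ℂ] H)) : H →L[ℂ] H)) Y) ∧
    (∀ Y : UnitaryOrbit.orbitSpan A f₀ →L[ℂ] UnitaryOrbit.orbitSpan A f₀,
      UnitaryOrbit.IsBoundedInverse (UnitaryOrbit.opXOn A f₀) Y →
        HasSum (fun l : ℤ => UnitaryOrbit.dCoeff A f₀ l • UnitaryOrbit.zpowOn A f₀ l) Y) := by
  obtain ⟨C, hC⟩ := UnitaryOrbit.exists_wienerBound_inv_sqrt ha hα
  obtain ⟨D, hD⟩ := UnitaryOrbit.exists_wienerBound_sqrt ha hα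
  have hpos := UnitaryOrbit.symbol_re_pos ha hα
  have hc : Summable fun k => ‖UnitaryOrbit.cCoeff A f₀ k‖ := hC.summable_fourierCoeffOn
  have hd : Summable fun k => ‖UnitaryOrbit.dCoeff A f₀ k‖ := hD.summable_fourierCoeffOn
  have hCD : ∀ p, ((1 / √(UnitaryOrbit.symbol A f₀ p).re : ℝ) : ℂ) *
      ((√(UnitaryOrbit.symbol A f₀ p).re : ℝ) : ℂ) = 1 := fun p => by
    rw [← ofReal_mul, one_div_mul_cancel (Real.sqrt_pos.2 (hpos p)).ne', ofReal_one]
  have hDC := fun p => (mul_comm _ _).trans (hCD p)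
  have hX := UnitaryOrbit.hasSum_opX hc
  have hXOn := UnitaryOrbit.hasSum_opXOn hc
  have hY := (summable_smul_of_norm_le_one hd (UnitaryOrbit.norm_zpow_le_one A)).hasSum
  have hYOn := (summable_smul_of_norm_le_one
    (E := UnitaryOrbit.orbitSpan A f₀ →L[ℂ] UnitaryOrbit.orbitSpan A f₀) hd
    (UnitaryOrbit.norm_zpowOn_le_one A f₀)).hasSum
  have hinv := UnitaryOrbit.isBoundedInverse_of_mul_eq_one
    (mul_eq_one_of_fourierCoeffOn (UnitaryOrbit.coe_zpow_zero A) (UnitaryOrbit.coe_zpow_add A)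
      (UnitaryOrbit.norm_zpow_le_one A) hD hC hDC hY hX)
    (mul_eq_one_of_fourierCoeffOn (UnitaryOrbit.coe_zpow_zero A) (UnitaryOrbit.coe_zpow_add A)
      (UnitaryOrbit.norm_zpow_le_one A) hC hD hCD hX hY)
  have hinvOn := UnitaryOrbit.isBoundedInverse_of_mul_eq_one
    (mul_eq_one_of_fourierCoeffOn (UnitaryOrbit.zpowOn_zero A f₀) (UnitaryOrbit.zpowOn_add A f₀)
      (UnitaryOrbit.norm_zpowOn_le_one A f₀) hD hC hDC hYOn hXOn)
    (mul_eq_one_of_fourierCoeffOn (UnitaryOrbit.zpowOn_zero A f₀) (UnitaryOrbit.zpowOn_add A f₀)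
      (UnitaryOrbit.norm_zpowOn_le_one A f₀) hC hD hCD hXOn hYOn)
  -- Completeness and both inverses are now unconditional, so the equivalences are immediate;
  -- uniqueness of inverses identifies any given `Y` with the `d`-series.
  have hcomplete := UnitaryOrbit.phiComplete_of_isBoundedInverse hY (hinv.1 f₀)
  exact ⟨fun p => ⟨UnitaryOrbit.symbol_im ha p, hpos p⟩, hc, UnitaryOrbit.orthonormal_phi ha hα,
    ⟨fun _ => ⟨_, hinv⟩, fun _ => hcomplete⟩, ⟨fun _ => ⟨_, hinvOn⟩, fun _ => hcomplete⟩,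
    fun _ h => h.unique hinv ▸ hY, fun _ h => h.unique hinvOn ▸ hYOn⟩
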